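/- Let $\mathcal{A}$ be a unital $C^*$-algebra, let $\mathcal{H}$ be a complex Hilbert space, let $\varphi:\mathcal{A}\to\mathscr{B}(\mathcal{H})$ be a completely positive (CP) map, and let $R\in\mathscr{B}(\mathcal{H})$. Call two linear maps $\eta,\theta:\mathcal{A}\to\mathscr{B}(\mathcal{H})$ *$R$-equivalent*, written $\eta\underset{R}{=}\theta$, if $\eta(X)R=\theta(X)R$ for all $X\in\mathcal{A}$. Then there exists a unique CP map $\alpha=\alpha_R:\mathcal{A}\to\mathscr{B}(\mathcal{H})$ with the following two properties: 1. $\varphi=\alpha+\varphi_1$ for some CP map $\varphi_1:\mathcal{A}\to\mathscr{B}(\mathcal{H})$, and $\varphi\underset{R}{=}\alpha$, $\varphi_1\underset{R}{=}0$. 2. Every CP map $\psi:\mathcal{A}\to\mathscr{B}(\mathcal{H})$ with $\varphi\underset{R}{=}\psi$ decomposes as $\psi=\alpha+\psi_1$ for some CP map $\psi_1:\mathcal{A}\to\mathscr{B}(\mathcal{H})$, and $\varphi\underset{R}{=}\alpha\underset{R}{=}\psi$, $\varphi_1\underset{R}{=}\psi_1\underset{R}{=}0$. (The uniqueness of $\alpha$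 is among CP maps having both properties.) -/

import Mathlib

open scoped CStarAlgebra

/-- Two linear maps `φ, ψ : A → B(H)` are `R`-equivalent, for an operator `R` on `H`, if
`φ(X) R = ψ(X) R` for every `X ∈ A` (the product in `B(H)` is composition). -/
def REquivalent {A H : Type*} [CStarAlgebra A] [NormedAddCommGroup H] [InnerProductSpace ℂ H]
    (R : H →L[ℂ] H) (φ ψ : A →ₗ[ℂ] (H →L[ℂ] H)) : Prop :=
  ∀ X : A, φ X * R = ψ X * R

open ContinuousLinearMap InnerProductSpace

set_option linter.unusedSectionVars false

/-! ### Detecting nonnegativity through negative parts -/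

section NegPart

variable {B : Type*} [NonUnitalCStarAlgebra B] [PartialOrder B] [StarOrderedRing B]

/-! Factor `φ (a⋆ b) = e(a)† e(b)` through a Hilbert space `K` (`exists_isDilation`), and let `P`
project onto the closed span of the vectors `e(a) R h`. Left multiplication acts boundedly on `K`
and commutes with `P`, so `α a = e(1)† P e(a)` satisfies `α (a⋆ b) = (P e(a))† P e(b)`. Hence `α` is
CP, as is `φ - α`, which has `1 - P` in place of `P`. Since `P` fixes `e(a) R h`, `α R = φ R`.

Minimality (`subCompression`): if `ψ` is `R`-equivalent to `φ` and `e'` dilates it, the pairings of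
the vectors `e(a) R h` with each other and with all `e(b) k` are unchanged when `e'` replaces `e`.
Cauchy–Schwarz then gives `‖P v‖ ≤ ‖v'‖` for corresponding `v`, `v'`, that is, `α ≤ ψ` in the CP
order. A least element is unique (`eq_of_eq_add`). -/

lemma exists_eq_star_mul_self_of_nonneg {T : B} (hT : 0 ≤ T) : ∃ S, T = star S * S :=
  CStarAlgebra.nonneg_iff_eq_star_mul_self.mp hT

/-- The algebraic properties of the negative part which detect nonnegativity. -/
lemma IsSelfAdjoint.exists_negPart {T : B} (hT : IsSelfAdjoint T) :
    ∃ N : B, IsSelfAdjoint N ∧ T * N = -(N * N) ∧ 0 ≤ N * N * N ∧ (N * N * N = 0 → 0 ≤ T) := by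
  have hN : IsSelfAdjoint T⁻ := (CFC.negPart_nonneg T).isSelfAdjoint
  refine ⟨T⁻, hN, ?_, ?_, fun hzero => ?_⟩
  · conv_lhs => rw [← CFC.posPart_sub_negPart T hT]
    rw [sub_mul, CFC.posPart_sub_negPart T hT, CFC.posPart_mul_negPart, zero_sub]
  · have := star_left_conjugate_nonneg (CFC.negPart_nonneg T) T⁻
    rwa [hN.star_eq] at this
  -- The C⋆-identity is used twice: `N³ = 0` gives `N⁴ = 0`, hence `N² = 0`, hence `N = 0`.
  · have hsq : T⁻ * T⁻ = 0 := by
      refine CStarRing.star_mul_self_eq_zero_iff _ |>.mp ?_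
      rw [star_mul, hN.star_eq, ← mul_assoc, hzero, zero_mul]
    have hz : T⁻ = 0 := by
      refine CStarRing.star_mul_self_eq_zero_iff _ |>.mp ?_
      rw [hN.star_eq, hsq]
    exact (CFC.negPart_eq_zero_iff T hT).mp hz

end NegPart

/-! ### Operator matrices and their quadratic forms -/

section MatrixPositivity

variable {n H : Type*} [Fintype n] [NormedAddCommGroup H] [InnerProductSpace ℂ H]
  [CompleteSpace H]

/-- The action of an operator matrix on a tuple of vectors. -/
def CStarMatrix.applyTuple (T : CStarMatrix n n (H →L[ℂ] H)) (v : n → H) : n → H :=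
  fun i => ∑ j, T i j (v j)

/-- The sesquilinear form on tuples of vectors attached to an operator matrix. -/
noncomputable def CStarMatrix.form (T : CStarMatrix n n (H →L[ℂ] H)) (v w : n → H) : ℂ :=
  ∑ i, inner ℂ (v i) (T.applyTuple w i)

namespace CStarMatrix

lemma applyTuple_mul (S T : CStarMatrix n n (H →L[ℂ] H)) (v : n → H) :
    (S * T).applyTuple v = S.applyTuple (T.applyTuple v) := by
  ext i
  simp only [applyTuple, mul_apply, _root_.sum_apply, map_sum]
  rw [Finset.sum_comm]
  rfl

lemma form_star (T : CStarMatrix n n (H →L[ℂ] H)) (v w : n → H) :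
    (star T).form v w = ∑ i, inner ℂ (T.applyTuple v i) (w i) := by
  simp only [form, applyTuple, inner_sum, sum_inner]
  rw [Finset.sum_comm]
  refine Finset.sum_congr rfl fun i _ => Finset.sum_congr rfl fun j _ => ?_
  rw [star_eq_conjTranspose, conjTranspose_apply, ContinuousLinearMap.star_eq_adjoint,
    ContinuousLinearMap.adjoint_inner_right]

lemma form_star_mul (S T : CStarMatrix n n (H →L[ℂ] H)) (v w : n → H) :
    (star S * T).form v w = ∑ i, inner ℂ (S.applyTuple v i) (T.applyTuple w i) := by
  rw [form, applyTuple_mul, ← form, form_star]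

lemma form_neg (T : CStarMatrix n n (H →L[ℂ] H)) (v w : n → H) :
    (-T).form v w = -T.form v w := by
  simp only [form, applyTuple, neg_apply, _root_.neg_apply, Finset.sum_neg_distrib,
    inner_neg_right]

lemma form_star_mul_self_re (S : CStarMatrix n n (H →L[ℂ] H)) (v : n → H) :
    ((star S * S).form v v).re = ∑ i, ‖S.applyTuple v i‖ ^ 2 := by
  rw [form_star_mul, Complex.re_sum]
  refine Finset.sum_congr rfl fun i _ => ?_
  rw [inner_self_eq_norm_sq_to_K]
  norm_cast

lemma form_re_nonneg {T : CStarMatrix n n (H →L[ℂ] H)} (hT : 0 ≤ T) (v : n → H) :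
    0 ≤ (T.form v v).re := by
  obtain ⟨S, rfl⟩ := exists_eq_star_mul_self_of_nonneg hT
  rw [form_star_mul_self_re]
  positivity

lemma eq_zero_of_applyTuple {T : CStarMatrix n n (H →L[ℂ] H)} (h : ∀ v, T.applyTuple v = 0) :
    T = 0 := by
  classical
  ext i j x
  simpa [applyTuple, Pi.single_apply, apply_ite] using congrFun (h (Pi.single j x)) i

lemma eq_zero_of_nonneg_of_form_re_nonpos {T : CStarMatrix n n (H →L[ℂ] H)} (hT : 0 ≤ T)
    (h : ∀ v, (T.form v v).re ≤ 0) : T = 0 := by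
  obtain ⟨S, rfl⟩ := exists_eq_star_mul_self_of_nonneg hT
  have hS : S = 0 := eq_zero_of_applyTuple fun v => by
    have h0 := h v
    rw [form_star_mul_self_re] at h0
    have h1 := (Finset.sum_eq_zero_iff_of_nonneg (fun i _ => by positivity)).mp
      (le_antisymm h0 (Finset.sum_nonneg fun i _ => by positivity))
    ext i
    simpa using h1 i (Finset.mem_univ i)
  simp [hS]

/-- A self-adjoint operator matrix whose quadratic form is nonnegative is nonnegative. -/
lemma nonneg_of_form_re_nonneg {T : CStarMatrix n n (H →L[ℂ] H)} (hT : IsSelfAdjoint T)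
    (h : ∀ v, 0 ≤ (T.form v v).re) : 0 ≤ T := by
  obtain ⟨N, hN, hTN, hcube, hconcl⟩ := IsSelfAdjoint.exists_negPart hT
  refine hconcl (eq_zero_of_nonneg_of_form_re_nonpos hcube fun v => ?_)
  -- Testing `T` on `N v` gives `⟨N v, T N v⟩ = -⟨v, N³ v⟩`, so the form of `N³ ≥ 0` is also
  -- nonpositive.
  have h1 : (star N * (T * N)).form v v = T.form (N.applyTuple v) (N.applyTuple v) := by
    rw [form_star_mul, applyTuple_mul, form]
  have h2 : (star N * (T * N)).form v v = -(N * N * N).form v v := by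
    rw [hTN, hN.star_eq, mul_neg, ← mul_assoc]
    exact form_neg _ v v
  have h3 := h (N.applyTuple v)
  rw [← h1, h2, Complex.neg_re] at h3
  linarith

end CStarMatrix

end MatrixPositivity

/-! ### Complete positivity through sums of inner products -/

section CompletePositivity

variable {A H : Type*} [CStarAlgebra A] [PartialOrder A] [StarOrderedRing A]
  [NormedAddCommGroup H] [InnerProductSpace ℂ H] [CompleteSpace H]

namespace CompletelyPositiveMap

lemma sum_inner_re_nonneg (φ : A →CP (H →L[ℂ] H)) {n : Type*} [Fintype n] (X : n → A)
    (h : n → H) : 0 ≤ (∑ i, ∑ j, inner ℂ (h i) (φ (star (X i) * X j) (h j))).re := by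
  cases isEmpty_or_nonempty n
  · simp
  classical
  obtain ⟨i₀⟩ := ‹Nonempty n›
  -- The only nonzero row of `C` is `X`, so `C⋆ C` has entries `X i⋆ X j`.
  let C : CStarMatrix n n A := fun i j => if i = i₀ then X j else 0
  have hC : ∀ i j, (star C * C) i j = star (X i) * X j := by
    intro i j
    rw [CStarMatrix.mul_apply, Finset.sum_eq_single i₀]
    · rw [CStarMatrix.star_apply]
      simp [C]
    · intro l _ hl
      simp [C, hl]
    · simp
  have := CStarMatrix.form_re_nonneg
    (φ.map_cstarMatrix_nonneg (star C * C) (star_mul_self_nonneg C)) h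
  simpa only [CStarMatrix.form, CStarMatrix.applyTuple, inner_sum, CStarMatrix.map_apply, hC]
    using this

/-- A Hermitian linear map with nonnegative quadratic forms is completely positive. -/
def ofSumInnerNonneg (β : A →ₗ[ℂ] (H →L[ℂ] H)) (hstar : ∀ a, β (star a) = star (β a))
    (hβ : ∀ (k : ℕ) (X : Fin k → A) (h : Fin k → H),
      0 ≤ (∑ i, ∑ j, inner ℂ (h i) (β (star (X i) * X j) (h j))).re) :
    A →CP (H →L[ℂ] H) where
  toLinearMap := β
  map_cstarMatrix_nonneg' k M hM := by
    refine CStarMatrix.nonneg_of_form_re_nonneg ?_ fun v => ?_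
    · ext1 i j
      rw [CStarMatrix.star_apply, CStarMatrix.map_apply, CStarMatrix.map_apply, ← hstar,
        CStarMatrix.star_apply_of_isSelfAdjoint hM.isSelfAdjoint]
    -- The form of `N⋆ N` splits over the rows of `N`, and each row falls under `hβ`.
    · obtain ⟨N, rfl⟩ := exists_eq_star_mul_self_of_nonneg hM
      have : CStarMatrix.form ((star N * N).map β) v v =
          ∑ l, ∑ i, ∑ j, inner ℂ (v i) (β (star (N l i) * N l j) (v j)) := by
        rw [Finset.sum_comm]
        simp only [CStarMatrix.form, CStarMatrix.applyTuple, inner_sum, CStarMatrix.map_apply,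
          CStarMatrix.mul_apply, CStarMatrix.star_apply, map_sum,
          _root_.sum_apply]
        refine Finset.sum_congr rfl fun i _ => ?_
        rw [Finset.sum_comm]
      change 0 ≤ (CStarMatrix.form ((star N * N).map β) v v).re
      rw [this, Complex.re_sum]
      exact Finset.sum_nonneg fun l _ => hβ k (N l) v

lemma map_star' (φ : A →CP (H →L[ℂ] H)) (a : A) : φ (star a) = star (φ a) :=
  map_star φ a

/-- A linear map factoring as `β (a⋆ b) = f(a)† f(b)` is completely positive. -/
noncomputable def ofFactorization {K : Type*} [NormedAddCommGroup K] [InnerProductSpace ℂ K]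
    (β : A →ₗ[ℂ] (H →L[ℂ] H)) (f : A → H →L[ℂ] K)
    (hf : ∀ a b h g, inner ℂ (f a h) (f b g) = inner ℂ h (β (star a * b) g)) :
    A →CP (H →L[ℂ] H) :=
  ofSumInnerNonneg β
    (fun a => by
      ext g
      refine ext_inner_left ℂ fun h => ?_
      have h1 := hf 1 a g h
      have h2 := hf a 1 h g
      rw [mul_one] at h2
      rw [star_one, one_mul] at h1
      rw [← h2, ContinuousLinearMap.star_eq_adjoint, ContinuousLinearMap.adjoint_inner_right,
        ← inner_conj_symm, h1, inner_conj_symm])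
    (fun k X h => by
      have : ∑ i, ∑ j, inner ℂ (h i) (β (star (X i) * X j) (h j)) =
          inner ℂ (∑ i, f (X i) (h i)) (∑ i, f (X i) (h i)) := by
        simp only [sum_inner, inner_sum, hf]
        exact Finset.sum_comm
      rw [this]
      exact inner_self_nonneg (𝕜 := ℂ))

lemma toLinearMap_injective {φ ψ : A →CP (H →L[ℂ] H)} (h : φ.toLinearMap = ψ.toLinearMap) :
    φ = ψ := by
  cases φ; cases ψ; congr

/-- If two completely positive maps dominate each other, they agree. -/
lemma eq_of_eq_add {φ ψ φ' ψ' : A →CP (H →L[ℂ] H)}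
    (h : φ.toLinearMap = ψ.toLinearMap + φ'.toLinearMap)
    (h' : ψ.toLinearMap = φ.toLinearMap + ψ'.toLinearMap) : φ = ψ := by
  -- Nonnegative elements span `A`, and on them antisymmetry of the operator order applies.
  refine toLinearMap_injective (LinearMap.ext_on (CStarAlgebra.span_nonneg (A := A)) ?_)
  intro a ha
  have h1 : 0 ≤ φ'.toLinearMap a := map_nonneg φ' ha
  have h2 : 0 ≤ ψ'.toLinearMap a := map_nonneg ψ' ha
  have e1 := LinearMap.congr_fun h a
  have e2 := LinearMap.congr_fun h' a
  rw [LinearMap.add_apply] at e1 e2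
  exact le_antisymm (e2 ▸ le_add_of_nonneg_right h2) (e1 ▸ le_add_of_nonneg_right h1)

end CompletelyPositiveMap

end CompletePositivity
-- Finite sums of vectors from an operator family; reducing subspaces
section FinsuppFamilies

variable {A H K K' : Type*} [NormedAddCommGroup H] [InnerProductSpace ℂ H]
  [NormedAddCommGroup K] [InnerProductSpace ℂ K] [NormedAddCommGroup K'] [InnerProductSpace ℂ K']

/-- The linear map `∑ a ⊗ h ↦ ∑ f(a) h` attached to a family of operators. -/
noncomputable def finsuppSynthesis (f : A → H →L[ℂ] K) : (A →₀ H) →ₗ[ℂ] K :=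
  Finsupp.lsum ℂ fun a => (f a).toLinearMap

lemma finsuppSynthesis_apply (f : A → H →L[ℂ] K) (x : A →₀ H) :
    finsuppSynthesis f x = x.sum fun a h => f a h := rfl

lemma finsuppSynthesis_single (f : A → H →L[ℂ] K) (a : A) (h : H) :
    finsuppSynthesis f (Finsupp.single a h) = f a h := by
  simp [finsuppSynthesis]

lemma inner_finsuppSynthesis (f g : A → H →L[ℂ] K) (x y : A →₀ H) :
    inner ℂ (finsuppSynthesis f x) (finsuppSynthesis g y) =
      x.sum fun a h => y.sum fun b k => inner ℂ (f a h) (g b k) := by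
  simp only [finsuppSynthesis_apply, Finsupp.sum_inner, Finsupp.inner_sum]
  exact Finsupp.sum_comm _ _ _

/-- An operator commutes with the projection onto a subspace that it reduces. -/
lemma starProjection_comm_of_invariant [CompleteSpace K] (S : Submodule ℂ K)
    [S.HasOrthogonalProjection] (T : K →L[ℂ] K) (h₁ : ∀ x ∈ S, T x ∈ S)
    (h₂ : ∀ x ∈ S, adjoint T x ∈ S) (x : K) :
    S.starProjection (T x) = T (S.starProjection x) := by
  refine Submodule.eq_starProjection_of_mem_orthogonal (h₁ _ (S.starProjection_apply_mem x)) ?_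
  rw [← map_sub, Submodule.mem_orthogonal]
  intro s hs
  rw [← adjoint_inner_left]
  exact Submodule.sub_starProjection_mem_orthogonal x _ (h₂ s hs)

end FinsuppFamilies

/-! ### Dilations and compression to the span of `e(a) R h` -/

section Dilation

variable {A H : Type*} [CStarAlgebra A] [PartialOrder A] [StarOrderedRing A]
  [NormedAddCommGroup H] [InnerProductSpace ℂ H] [CompleteSpace H]
  {K : Type*} [NormedAddCommGroup K] [InnerProductSpace ℂ K] [CompleteSpace K]

namespace CompletelyPositiveMap

/-- A family of operators factoring `φ (a⋆ b)` as `e(a)† e(b)`, with total range. -/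
structure IsDilation (φ : A →CP (H →L[ℂ] H)) (e : A → H →L[ℂ] K) : Prop where
  inner_eq : ∀ a b h g, inner ℂ (e a h) (e b g) = inner ℂ h (φ (star a * b) g)
  dense : DenseRange (finsuppSynthesis e)

/-- Every completely positive map has a dilation, on a reproducing kernel Hilbert space. -/
lemma exists_isDilation.{u, v} {A : Type u} {H : Type v} [CStarAlgebra A] [PartialOrder A]
    [StarOrderedRing A] [NormedAddCommGroup H] [InnerProductSpace ℂ H] [CompleteSpace H]
    (φ : A →CP (H →L[ℂ] H)) :
    ∃ (K : Type (max u v)) (_ : NormedAddCommGroup K) (_ : InnerProductSpace ℂ K) (_ : CompleteSpace K)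
      (e : A → H →L[ℂ] K), φ.IsDilation e := by
  let k : Matrix A A (H →L[ℂ] H) := fun a b => φ (star a * b)
  have hherm : k.IsHermitian := by
    ext1 a b
    rw [Matrix.conjTranspose_apply]
    change star (φ (star b * a)) = φ (star a * b)
    rw [← map_star φ, star_mul, star_star]
  have hk : k.PosSemidef := by
    have h2 := (RKHS.posSemidef_tfae (K := k)).out 0 2
    refine h2.mpr ⟨hherm, fun x => ?_⟩
    have h := φ.sum_inner_re_nonneg (n := x.support) (fun i => (i : A)) (fun i => x i)
    -- Conjugation swaps the arguments of each inner product, matching the kernel criterion, and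
    -- keeps the real part.
    rw [← Complex.conj_re] at h
    simp only [map_sum, inner_conj_symm] at h
    rw [Finset.sum_comm] at h
    convert h
    simp only [Finsupp.sum]
    rw [← Finset.sum_coe_sort x.support]
    refine congrArg Complex.re (Finset.sum_congr rfl fun i _ => ?_)
    rw [← Finset.sum_coe_sort x.support]
  have : Fact k.PosSemidef := ⟨hk⟩
  refine ⟨RKHS.OfKernel k, inferInstance, inferInstance, inferInstance,
    fun a => RKHS.kerFun (RKHS.OfKernel k) a, ⟨fun a b h g => ?_, ?_⟩⟩
  · rw [← adjoint_inner_right, ← ContinuousLinearMap.comp_apply, ← RKHS.kernel_apply,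
      RKHS.OfKernel.kernel_ofKernel]
  · have hd := RKHS.kerFun_dense (RKHS.OfKernel k)
    rw [← Submodule.dense_iff_topologicalClosure_eq_top] at hd
    refine hd.mono ?_
    rw [← LinearMap.coe_range, SetLike.coe_subset_coe, Submodule.span_le]
    rintro _ ⟨a, h, rfl⟩
    exact ⟨Finsupp.single a h, finsuppSynthesis_single _ _ _⟩

namespace IsDilation

variable {φ : A →CP (H →L[ℂ] H)} {e : A → H →L[ℂ] K}

lemma ext_inner (he : φ.IsDilation e) {u v : K}
    (h : ∀ a g, inner ℂ (e a g) u = inner ℂ (e a g) v) : u = v := by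
  refine he.dense.eq_of_inner_right ℂ fun x => ?_
  simp only [finsuppSynthesis_apply, Finsupp.sum_inner, h]

lemma apply_add (he : φ.IsDilation e) (a b : A) : e (a + b) = e a + e b := by
  ext h
  refine he.ext_inner fun c g => ?_
  simp [he.inner_eq, mul_add]

lemma apply_smul (he : φ.IsDilation e) (c : ℂ) (a : A) : e (c • a) = c • e a := by
  ext h
  refine he.ext_inner fun c g => ?_
  simp [he.inner_eq]

/-- Choose `d` with `d⋆ d = ‖c‖² - c⋆ c`, which is nonnegative; then `c⋆ c + d⋆ d` is a scalar.
Dropping the `d` term bounds left multiplication by `‖c‖`. -/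
lemma exists_norm_sq_add_norm_sq (he : φ.IsDilation e) (c : A) :
    ∃ d : A, ∀ x, ‖finsuppSynthesis (fun a => e (c * a)) x‖ ^ 2 +
      ‖finsuppSynthesis (fun a => e (d * a)) x‖ ^ 2 = (‖c‖ * ‖finsuppSynthesis e x‖) ^ 2 := by
  have hpos : 0 ≤ algebraMap ℝ A (‖c‖ ^ 2) - star c * c := by
    rw [sub_nonneg, sq, ← CStarRing.norm_star_mul_self]
    exact (IsSelfAdjoint.star_mul_self c).le_algebraMap_norm_self
  obtain ⟨d, hd⟩ := exists_eq_star_mul_self_of_nonneg hpos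
  refine ⟨d, fun x => ?_⟩
  have hsum : star c * c + star d * d = ((‖c‖ ^ 2 : ℝ) : ℂ) • (1 : A) := by
    rw [← hd, add_sub_cancel, Algebra.algebraMap_eq_smul_one, Complex.coe_smul]
  rw [← Complex.ofReal_inj, mul_pow]
  push_cast
  have key : ∀ f : A → H →L[ℂ] K, ((‖finsuppSynthesis f x‖ : ℂ)) ^ 2 =
      x.sum fun a h => x.sum fun b k => inner ℂ (f a h) (f b k) := fun f => by
    rw [← inner_finsuppSynthesis, inner_self_eq_norm_sq_to_K]
    rfl
  rw [key, key, key]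
  simp only [he.inner_eq, Finsupp.sum, Finset.mul_sum, ← Finset.sum_add_distrib]
  refine Finset.sum_congr rfl fun a _ => Finset.sum_congr rfl fun b _ => ?_
  have : star (c * a) * (c * b) + star (d * a) * (d * b) = ((‖c‖ ^ 2 : ℝ) : ℂ) • (star a * b) := by
    have h2 : star (c * a) * (c * b) + star (d * a) * (d * b) =
        star a * (star c * c + star d * d) * b := by
      simp only [star_mul]; noncomm_ring
    rw [h2, hsum]
    simp
  rw [← inner_add_right, ← _root_.add_apply, ← map_add, this, map_smul,
    _root_.smul_apply, inner_smul_right]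
  push_cast
  rfl

/-- Left multiplication acts on the dilation space by bounded operators. -/
lemma exists_leftMul (he : φ.IsDilation e) (c : A) :
    ∃ T : K →L[ℂ] K, ∀ a h, T (e a h) = e (c * a) h := by
  have hb : ∀ x, ‖finsuppSynthesis (fun a => e (c * a)) x‖ ≤ ‖c‖ * ‖finsuppSynthesis e x‖ := by
    intro x
    obtain ⟨d, hd⟩ := he.exists_norm_sq_add_norm_sq c
    refine (sq_le_sq₀ (by positivity) (by positivity)).mp ?_
    rw [← hd x]
    exact le_add_of_nonneg_right (by positivity)
  refine ⟨(finsuppSynthesis fun a => e (c * a)).extendOfNorm (finsuppSynthesis e),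
    fun a h => ?_⟩
  have := LinearMap.extendOfNorm_eq he.dense ⟨‖c‖, hb⟩ (Finsupp.single a h)
  simpa only [finsuppSynthesis_single] using this

lemma adjoint_leftMul (he : φ.IsDilation e) {c : A} {T : K →L[ℂ] K}
    (hT : ∀ a h, T (e a h) = e (c * a) h) (a : A) (h : H) :
    adjoint T (e a h) = e (star c * a) h := by
  refine he.ext_inner fun b g => ?_
  rw [adjoint_inner_right, hT, he.inner_eq, he.inner_eq, star_mul, mul_assoc]

/-- The closed span of the vectors `e(a) R h`. -/
noncomputable def subspace (e : A → H →L[ℂ] K) (R : H →L[ℂ] H) : Submodule ℂ K :=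
  (LinearMap.range (finsuppSynthesis fun a => e a ∘L R)).topologicalClosure

instance (e : A → H →L[ℂ] K) (R : H →L[ℂ] H) : CompleteSpace (subspace e R) :=
  inferInstanceAs (CompleteSpace (LinearMap.range _).topologicalClosure)

lemma mem_subspace (e : A → H →L[ℂ] K) (R : H →L[ℂ] H) (a : A) (h : H) :
    e a (R h) ∈ subspace e R :=
  Submodule.le_topologicalClosure _ ⟨Finsupp.single a h, finsuppSynthesis_single _ _ _⟩

lemma map_mem_subspace (R : H →L[ℂ] H) {T : K →L[ℂ] K}
    {c : A} (hT : ∀ a h, T (e a h) = e (c * a) h) {x : K} (hx : x ∈ subspace e R) :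
    T x ∈ subspace e R := by
  have hle : subspace e R ≤ (subspace e R).comap T.toLinearMap := by
    refine Submodule.topologicalClosure_minimal _ ?_
      ((Submodule.isClosed_topologicalClosure _).preimage T.continuous)
    rintro _ ⟨x, rfl⟩
    rw [finsuppSynthesis_apply]
    refine Submodule.sum_mem _ fun a _ => ?_
    rw [Submodule.mem_comap]
    change T (e a (R (x a))) ∈ _
    rw [hT]
    exact mem_subspace e R _ _
  exact hle hx

/-- The compressed kernel depends only on `a⋆ b`. -/
lemma inner_starProjection (he : φ.IsDilation e) (R : H →L[ℂ] H) (a b : A) (h g : H) :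
    inner ℂ (e a h) ((subspace e R).starProjection (e b g)) =
      inner ℂ (e 1 h) ((subspace e R).starProjection (e (star a * b) g)) := by
  obtain ⟨T, hT⟩ := he.exists_leftMul a
  have hT' := he.adjoint_leftMul hT
  have h1 : T (e 1 h) = e a h := by rw [hT, mul_one]
  -- `T` and its adjoint are left multiplications by `a` and `a⋆`; both preserve the subspace, so
  -- they commute with the projection.
  rw [← h1, ← adjoint_inner_right, ← hT', starProjection_comm_of_invariant]
  · exact fun x hx => map_mem_subspace R hT' hx
  · rw [adjoint_adjoint]
    exact fun x hx => map_mem_subspace R hT hx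

/-- The compression of `φ` to the closed span of the vectors `e(a) R h`. -/
noncomputable def compressionₗ (he : φ.IsDilation e) (R : H →L[ℂ] H) : A →ₗ[ℂ] (H →L[ℂ] H) where
  toFun a := adjoint (e 1) ∘L (subspace e R).starProjection ∘L e a
  map_add' a b := by simp [he.apply_add]
  map_smul' c a := by simp [he.apply_smul]

lemma inner_compressionₗ (he : φ.IsDilation e) (R : H →L[ℂ] H) (a b : A) (h g : H) :
    inner ℂ h (he.compressionₗ R (star a * b) g) =
      inner ℂ (e a h) ((subspace e R).starProjection (e b g)) := by
  rw [inner_starProjection he, ← adjoint_inner_right]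
  rfl

lemma inner_starProjection_starProjection (S : Submodule ℂ K) [S.HasOrthogonalProjection]
    (u v : K) : inner ℂ (S.starProjection u) (S.starProjection v) =
      inner ℂ u (S.starProjection v) := by
  rw [Submodule.inner_starProjection_left_eq_right,
    Submodule.starProjection_eq_self_iff.mpr (S.starProjection_apply_mem v)]

/-- The compression as a completely positive map. -/
noncomputable def compression (he : φ.IsDilation e) (R : H →L[ℂ] H) : A →CP (H →L[ℂ] H) :=
  ofFactorization (he.compressionₗ R) (fun a => (subspace e R).starProjection ∘L e a)
    fun a b h g => by
      rw [inner_compressionₗ]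
      exact inner_starProjection_starProjection _ _ _

/-- The complement of the compression as a completely positive map. -/
noncomputable def cocompression (he : φ.IsDilation e) (R : H →L[ℂ] H) : A →CP (H →L[ℂ] H) :=
  ofFactorization (φ.toLinearMap - he.compressionₗ R)
    (fun a => e a - (subspace e R).starProjection ∘L e a)
    fun a b h g => by
      change inner ℂ (e a h - (subspace e R).starProjection (e a h))
        (e b g - (subspace e R).starProjection (e b g)) =
        inner ℂ h (φ (star a * b) g - he.compressionₗ R (star a * b) g)
      rw [inner_sub_right h, inner_compressionₗ, inner_sub_left, inner_sub_right, inner_sub_right,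
        inner_starProjection_starProjection,
        Submodule.inner_starProjection_left_eq_right, he.inner_eq]
      ring

lemma compression_mul (he : φ.IsDilation e) (R : H →L[ℂ] H) (a : A) :
    he.compressionₗ R a * R = φ a * R := by
  ext g
  refine ext_inner_left ℂ fun h => ?_
  change inner ℂ h (he.compressionₗ R a (R g)) = inner ℂ h (φ a (R g))
  have h1 := he.inner_compressionₗ R 1 a h (R g)
  rw [Submodule.starProjection_eq_self_iff.mpr (mem_subspace e R a g), he.inner_eq] at h1
  simpa using h1

variable {ψ : A →CP (H →L[ℂ] H)}

/-- The difference between a completely positive map `R`-equivalent to `φ` and the compression of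
`φ`, as a completely positive map. -/
noncomputable def subCompression (he : φ.IsDilation e) (R : H →L[ℂ] H)
    (hψ : ∀ a, φ a * R = ψ a * R) : A →CP (H →L[ℂ] H) :=
  ofSumInnerNonneg (ψ.toLinearMap - he.compressionₗ R)
    (fun a => by
      rw [LinearMap.sub_apply, LinearMap.sub_apply, star_sub]
      exact congrArg₂ _ (map_star' ψ a) (map_star' (he.compression R) a))
    (fun k X h => by
      obtain ⟨K', _, _, _, e', he'⟩ := ψ.exists_isDilation
      have hR : ∀ a h, φ a (R h) = ψ a (R h) := fun a h =>
        congrArg (fun T : H →L[ℂ] H => T h) (hψ a)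
      set P := (subspace e R).starProjection with hP
      set v := ∑ i, e (X i) (h i) with hv
      set v' := ∑ i, e' (X i) (h i) with hv'
      have hsum : ∑ i, ∑ j, inner ℂ (h i)
          ((ψ.toLinearMap - he.compressionₗ R) (star (X i) * X j) (h j)) =
          inner ℂ v' v' - inner ℂ v (P v) := by
        simp only [LinearMap.sub_apply, _root_.sub_apply, inner_sub_right,
          inner_compressionₗ, Finset.sum_sub_distrib]
        congr 1
        · rw [hv', sum_inner]
          refine Finset.sum_congr rfl fun i _ => ?_
          rw [inner_sum]
          exact Finset.sum_congr rfl fun j _ => (he'.inner_eq _ _ _ _).symm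
        · rw [hv, sum_inner]
          refine Finset.sum_congr rfl fun i _ => ?_
          rw [map_sum, inner_sum]
      -- By closedness it suffices to take `u = ∑ e(a) R y(a)`. Replacing `e` by `e'` changes
      -- neither its norm nor its pairing with `v`, since both only involve `φ(·) R = ψ(·) R`.
      have hbound : ∀ u ∈ subspace e R, ‖inner ℂ u v‖ ≤ ‖u‖ * ‖v'‖ := by
        intro u hu
        refine closure_minimal (t := {u : K | ‖inner ℂ u v‖ ≤ ‖u‖ * ‖v'‖}) ?_
          (isClosed_le (by fun_prop) (by fun_prop)) hu
        rintro _ ⟨y, rfl⟩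
        have h1 : inner ℂ (finsuppSynthesis (fun a => e a ∘L R) y) v =
            inner ℂ (finsuppSynthesis (fun a => e' a ∘L R) y) v' := by
          simp only [finsuppSynthesis_apply, Finsupp.sum_inner, hv, hv', inner_sum,
            ContinuousLinearMap.comp_apply]
          refine Finset.sum_congr rfl fun a _ => Finset.sum_congr rfl fun i _ => ?_
          change inner ℂ (e i (R (y i))) (e (X a) (h a)) = inner ℂ (e' i (R (y i))) (e' (X a) (h a))
          rw [← inner_conj_symm, he.inner_eq, hR, ← he'.inner_eq, inner_conj_symm]
        have h2 : ‖finsuppSynthesis (fun a => e a ∘L R) y‖ =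
            ‖finsuppSynthesis (fun a => e' a ∘L R) y‖ := by
          rw [← sq_eq_sq₀ (norm_nonneg _) (norm_nonneg _), ← inner_self_eq_norm_sq (𝕜 := ℂ),
            ← inner_self_eq_norm_sq (𝕜 := ℂ), inner_finsuppSynthesis, inner_finsuppSynthesis]
          simp only [ContinuousLinearMap.comp_apply, he.inner_eq, he'.inner_eq, hR]
        change ‖inner ℂ _ v‖ ≤ _
        rw [h1, h2]
        exact norm_inner_le_norm _ _
      have hPv : inner ℂ v (P v) = ((‖P v‖ ^ 2 : ℝ) : ℂ) := by
        rw [hP, ← inner_starProjection_starProjection, inner_self_eq_norm_sq_to_K]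
        norm_cast
      -- Take `u = P v` in `hbound`: `‖P v‖² ≤ ‖P v‖ ‖v'‖`.
      have hle : ‖P v‖ ≤ ‖v'‖ := by
        have h3 := hbound (P v) ((subspace e R).starProjection_apply_mem v)
        rw [norm_inner_symm, hPv, Complex.norm_real, Real.norm_of_nonneg (by positivity), sq] at h3
        by_cases h0 : ‖P v‖ = 0
        · rw [h0]; positivity
        · exact le_of_mul_le_mul_left h3 (lt_of_le_of_ne (norm_nonneg _) (Ne.symm h0))
      rw [hsum, hPv, inner_self_eq_norm_sq_to_K]
      have h4 : ((‖v'‖ : ℂ)) ^ 2 = ((‖v'‖ ^ 2 : ℝ) : ℂ) := by norm_cast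
      change 0 ≤ (((‖v'‖ : ℂ)) ^ 2 - _).re
      rw [h4, ← Complex.ofReal_sub, Complex.ofReal_re, sub_nonneg]
      gcongr)

end IsDilation

end CompletelyPositiveMap

end Dilation

/-! ### Existence and uniqueness of the least `R`-equivalent CP map -/

theorem mainTheorem4 {A H : Type*} [CStarAlgebra A] [PartialOrder A] [StarOrderedRing A]
    [NormedAddCommGroup H] [InnerProductSpace ℂ H] [CompleteSpace H]
    (φ : A →CP (H →L[ℂ] H)) (R : H →L[ℂ] H) :
    ∃! α : A →CP (H →L[ℂ] H),
      ∃ φ₁ : A →CP (H →L[ℂ] H),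
        (φ.toLinearMap = α.toLinearMap + φ₁.toLinearMap ∧
          REquivalent R φ.toLinearMap α.toLinearMap ∧
          REquivalent R φ₁.toLinearMap 0) ∧
        ∀ ψ : A →CP (H →L[ℂ] H), REquivalent R φ.toLinearMap ψ.toLinearMap →
          ∃ ψ₁ : A →CP (H →L[ℂ] H),
            ψ.toLinearMap = α.toLinearMap + ψ₁.toLinearMap ∧
            REquivalent R φ.toLinearMap α.toLinearMap ∧
            REquivalent R α.toLinearMap ψ.toLinearMap ∧
            REquivalent R φ₁.toLinearMap ψ₁.toLinearMap ∧
            REquivalent R ψ₁.toLinearMap 0 := by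
  obtain ⟨K, _, _, _, e, he⟩ := φ.exists_isDilation
  have hα : REquivalent R φ.toLinearMap (he.compression R).toLinearMap :=
    fun X => (he.compression_mul R X).symm
  have hφ₁ : REquivalent R (he.cocompression R).toLinearMap 0 := fun X => by
    change (φ.toLinearMap X - (he.compression R).toLinearMap X) * R = 0 * R
    rw [sub_mul, hα X, sub_self, zero_mul]
  refine ⟨he.compression R, ⟨he.cocompression R, ⟨(add_sub_cancel _ _).symm, hα, hφ₁⟩,
    fun ψ hψ => ?_⟩, fun β hβ => ?_⟩
  · have hψ₁ : REquivalent R (he.subCompression R hψ).toLinearMap 0 := fun X => by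
      change (ψ.toLinearMap X - (he.compression R).toLinearMap X) * R = 0 * R
      rw [sub_mul, ← hα X, ← hψ X, sub_self, zero_mul]
    exact ⟨he.subCompression R hψ, (add_sub_cancel _ _).symm, hα,
      fun X => (hα X).symm.trans (hψ X), fun X => (hφ₁ X).trans (hψ₁ X).symm, hψ₁⟩
  · obtain ⟨β₁, ⟨-, hβR, -⟩, hmin⟩ := hβ
    -- The compression is itself `R`-equivalent to `φ`, so `β` lies below it; minimality of the
    -- compression gives the reverse.
    obtain ⟨γ, hγ, -⟩ := hmin (he.compression R) hα
    exact CompletelyPositiveMap.eq_of_eq_add (φ' := he.subCompression R hβR)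
      (add_sub_cancel _ _).symm hγ
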